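/- Let $G=\mathbb{R}^{m}\ltimes_{\phi}\mathbb{R}^{n}$, where $\phi:\mathbb{R}^m\to GL(n,\mathbb{R})$ is a continuous homomorphism whose associated linear action of $\mathbb{R}^m$ on $\mathbb{R}^n$ is semisimple (every invariant subspace has an invariant complement); the multiplication is $(a,x)(b,y)=(a+b,\,x+\phi(a)y)$. Suppose that $\dim [G,G]>\frac{\dim G}{2}$ and that $G$ has a lattice $\Gamma$ (a discrete subgroup with compact quotient). Write $G/\Gamma$ for the compact manifold of orbits of the left multiplication action of $\Gamma$ on $G$, so that left-invariant forms on $G$ descend to $G/\Gamma$; a form on $G/\Gamma$ is called left-invariant if its pullback to $G$ is left-invariant. Let $\omega$ be a left-invariant locally conformal symplectic form on $G/\Gamma$ with left-invariant Lee form $\theta$; that is, $\omega$ is a smooth non-degenerate left-invariant $2$-form and $\theta$ is a closed left-invariant $1$-form with $d\omega=\theta\wedge\omega$. Then the class $[\omega]_\theta$ is not $0$ in $H^2_\theta(G/\Gamma)$, where $H^{*}_\theta(G/\Gamma)$ is the cohomology of the de Rham complex of smooth forms on $G/\Gamma$ with the differential $d_\theta\alpha=d\alpha-\theta\wedge\alpha$.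 -/

import Mathlib

open scoped Manifold Topology

noncomputable section

/-! ### Differential forms on manifolds and the cohomology of `d_θ` -/

namespace LCSForms

section Forms

variable {E : Type*} [NormedAddCommGroup E] [NormedSpace ℝ E]
variable {M : Type*} [TopologicalSpace M] [ChartedSpace E M]
variable {N : Type*} [TopologicalSpace N] [ChartedSpace E N]

variable (E M) in
/-- Differential `k`-forms (not necessarily smooth) on a manifold `M` modelled on `E`. -/
@[ext]
structure DiffForm (k : ℕ) where
  /-- The value of the form at a point. -/
  toFun : ∀ x : M, (TangentSpace 𝓘(ℝ, E) x) [⋀^Fin k]→L[ℝ] ℝ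

namespace DiffForm

variable {k : ℕ}

instance : CoeFun (DiffForm E M k) fun _ =>
    ∀ x : M, (TangentSpace 𝓘(ℝ, E) x) [⋀^Fin k]→L[ℝ] ℝ := ⟨toFun⟩

instance : Zero (DiffForm E M k) := ⟨⟨fun _ => 0⟩⟩

instance : Add (DiffForm E M k) := ⟨fun α β => ⟨fun x => α x + β x⟩⟩

instance : Neg (DiffForm E M k) := ⟨fun α => ⟨fun x => -α x⟩⟩

instance : Sub (DiffForm E M k) := ⟨fun α β => ⟨fun x => α x - β x⟩⟩

instance : SMul ℝ (DiffForm E M k) := ⟨fun c α => ⟨fun x => c • α x⟩⟩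

instance : SMul ℕ (DiffForm E M k) := ⟨fun c α => ⟨fun x => c • α x⟩⟩

instance : SMul ℤ (DiffForm E M k) := ⟨fun c α => ⟨fun x => c • α x⟩⟩

@[simp]
theorem add_apply (α β : DiffForm E M k) (x : M) : (α + β) x = α x + β x := rfl

@[simp]
theorem sub_apply (α β : DiffForm E M k) (x : M) : (α - β) x = α x - β x := rfl

@[simp]
theorem neg_apply (α : DiffForm E M k) (x : M) : (-α) x = -α x := rfl

@[simp]
theorem smul_apply (c : ℝ) (α : DiffForm E M k) (x : M) : (c • α) x = c • α x := rfl

@[simp]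
theorem zero_apply (x : M) : (0 : DiffForm E M k) x = 0 := rfl

theorem toFun_injective : Function.Injective (toFun : DiffForm E M k → _) :=
  fun _ _ h => DiffForm.ext h

instance : AddCommGroup (DiffForm E M k) :=
  toFun_injective.addCommGroup _ rfl (fun _ _ => rfl) (fun _ => rfl) (fun _ _ => rfl)
    (fun _ _ => rfl) (fun _ _ => rfl)

instance : Module ℝ (DiffForm E M k) :=
  toFun_injective.module ℝ ⟨⟨toFun, rfl⟩, fun _ _ => rfl⟩ (fun _ _ => rfl)

end DiffForm

/-- The pullback `f^* ω`. -/
def pullback {k : ℕ} (f : M → N) (ω : DiffForm E N k) : DiffForm E M k :=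
  ⟨fun x => (ω (f x)).compContinuousLinearMap (mfderiv 𝓘(ℝ, E) 𝓘(ℝ, E) f x)⟩

/-- The expression of a form in the chart `e`: the pullback of `ω` under `e⁻¹`, a form on `E`. -/
def inChart {k : ℕ} (e : OpenPartialHomeomorph M E) (ω : DiffForm E M k) :
    E → E [⋀^Fin k]→L[ℝ] ℝ :=
  fun y => pullback (M := E) e.symm ω y

/-- A form is smooth if its expressions in the charts are smooth. -/
def IsSmoothForm {k : ℕ} (ω : DiffForm E M k) : Prop :=
  ∀ x : M, ContDiffOn ℝ ((⊤ : ℕ∞) : WithTop ℕ∞) (inChart (chartAt E x) ω) (chartAt E x).target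

/-- The exterior derivative, computed at `x` in the chart at `x`. -/
def extd {k : ℕ} (ω : DiffForm E M k) : DiffForm E M (k + 1) where
  toFun x := ContinuousAlternatingMap.compContinuousLinearMap
    (extDeriv (inChart (chartAt E x) ω) (chartAt E x x))
    (mfderiv 𝓘(ℝ, E) 𝓘(ℝ, E) (chartAt E x) x : TangentSpace 𝓘(ℝ, E) x →L[ℝ] E)

/-- The wedge product of a linear form and an alternating `k`-form. -/
def wedgeAlt {k : ℕ} (t : E [⋀^Fin 1]→L[ℝ] ℝ) (a : E [⋀^Fin k]→L[ℝ] ℝ) :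
    E [⋀^Fin (k + 1)]→L[ℝ] ℝ :=
  ContinuousAlternatingMap.alternatizeUncurryFin
    (((ContinuousAlternatingMap.ofSubsingleton ℝ E ℝ (0 : Fin 1)).symm t).smulRight a)

theorem wedgeAlt_apply {k : ℕ} (t : E [⋀^Fin 1]→L[ℝ] ℝ) (a : E [⋀^Fin k]→L[ℝ] ℝ)
    (v : Fin (k + 1) → E) :
    wedgeAlt t a v = ∑ i : Fin (k + 1), (-1 : ℝ) ^ (i : ℕ) * (t ![v i] * a (i.removeNth v)) := by
  rw [wedgeAlt, ContinuousAlternatingMap.alternatizeUncurryFin_apply]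
  refine Finset.sum_congr rfl fun i _ => ?_
  have h : (ContinuousAlternatingMap.ofSubsingleton ℝ E ℝ (0 : Fin 1)).symm t (v i) = t ![v i] :=
    congrArg t (funext fun j => by rw [Subsingleton.elim j 0]; rfl)
  simp [zsmul_eq_mul, h]

theorem wedgeAlt_add {k : ℕ} (t : E [⋀^Fin 1]→L[ℝ] ℝ) (a b : E [⋀^Fin k]→L[ℝ] ℝ) :
    wedgeAlt t (a + b) = wedgeAlt t a + wedgeAlt t b := by
  ext v
  simp only [wedgeAlt_apply, ContinuousAlternatingMap.add_apply, mul_add, Finset.sum_add_distrib]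

theorem wedgeAlt_smul {k : ℕ} (t : E [⋀^Fin 1]→L[ℝ] ℝ) (c : ℝ) (a : E [⋀^Fin k]→L[ℝ] ℝ) :
    wedgeAlt t (c • a) = c • wedgeAlt t a := by
  ext v
  simp only [wedgeAlt_apply, ContinuousAlternatingMap.smul_apply, smul_eq_mul, Finset.mul_sum]
  exact Finset.sum_congr rfl fun i _ => by ring

/-- The wedge product `θ ∧ α` of a `1`-form and a `k`-form, with
`(θ ∧ α)(v₀, …, v_k) = ∑ i, (-1) ^ i θ(v_i) α(v₀, …, v̂_i, …, v_k)`. -/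
def wedge {k : ℕ} (θ : DiffForm E M 1) (α : DiffForm E M k) : DiffForm E M (k + 1) where
  toFun x := wedgeAlt (E := E) (θ x) (α x)

/-- `d_θ α = dα - θ ∧ α`. -/
def twistedD {k : ℕ} (θ : DiffForm E M 1) (α : DiffForm E M k) : DiffForm E M (k + 1) :=
  extd α - wedge θ α

theorem inChart_add {k : ℕ} (e : OpenPartialHomeomorph M E) (α β : DiffForm E M k) :
    inChart e (α + β) = inChart e α + inChart e β := by
  rfl

theorem inChart_smul {k : ℕ} (e : OpenPartialHomeomorph M E) (c : ℝ) (α : DiffForm E M k) :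
    inChart e (c • α) = c • inChart e α := by
  rfl

theorem IsSmoothForm.add {k : ℕ} {α β : DiffForm E M k} (hα : IsSmoothForm α)
    (hβ : IsSmoothForm β) : IsSmoothForm (α + β) := by
  intro x
  rw [inChart_add]
  exact (hα x).add (hβ x)

theorem IsSmoothForm.smul {k : ℕ} {α : DiffForm E M k} (c : ℝ) (hα : IsSmoothForm α) :
    IsSmoothForm (c • α) := by
  intro x
  rw [inChart_smul]
  exact (hα x).const_smul c

theorem IsSmoothForm.zero {k : ℕ} : IsSmoothForm (0 : DiffForm E M k) :=
  fun _ => contDiffOn_const (c := (0 : E [⋀^Fin k]→L[ℝ] ℝ))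

theorem twistedD_add {k : ℕ} (θ : DiffForm E M 1) {α β : DiffForm E M k} (hα : IsSmoothForm α)
    (hβ : IsSmoothForm β) : twistedD θ (α + β) = twistedD θ α + twistedD θ β := by
  have hd : ∀ γ : DiffForm E M k, IsSmoothForm γ → ∀ x : M,
      DifferentiableAt ℝ (inChart (chartAt E x) γ) (chartAt E x x) := fun γ hγ x =>
    ((hγ x).contDiffAt ((chartAt E x).open_target.mem_nhds
      (mem_chart_target E x))).differentiableAt (by simp)
  have h1 : extd (α + β) = extd α + extd β := by
    refine DiffForm.ext (funext fun x => ?_)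
    simp only [extd, inChart_add, extDeriv_add (hd α hα x) (hd β hβ x)]
    rfl
  have h2 : wedge θ (α + β) = wedge θ α + wedge θ β :=
    DiffForm.ext (funext fun x => wedgeAlt_add (E := E) (θ x) (α x) (β x))
  rw [twistedD, twistedD, twistedD, h1, h2]
  abel

theorem twistedD_smul {k : ℕ} (θ : DiffForm E M 1) (c : ℝ) (α : DiffForm E M k) :
    twistedD θ (c • α) = c • twistedD θ α := by
  have h1 : extd (c • α) = c • extd α := by
    refine DiffForm.ext (funext fun x => ?_)
    simp only [extd, inChart_smul, extDeriv_smul]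
    rfl
  have h2 : wedge θ (c • α) = c • wedge θ α :=
    DiffForm.ext (funext fun x => wedgeAlt_smul (E := E) (θ x) c (α x))
  rw [twistedD, twistedD, h1, h2, smul_sub]

/-- The smooth `d_θ`-closed `k`-forms. -/
def twistedCocycles (θ : DiffForm E M 1) (k : ℕ) : Submodule ℝ (DiffForm E M k) where
  carrier := {α | IsSmoothForm α ∧ twistedD θ α = 0}
  zero_mem' := ⟨.zero, by simpa using twistedD_smul θ 0 (0 : DiffForm E M k)⟩
  add_mem' ha hb := ⟨ha.1.add hb.1, by rw [twistedD_add θ ha.1 hb.1, ha.2, hb.2, add_zero]⟩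
  smul_mem' c _ ha := ⟨ha.1.smul c, by rw [twistedD_smul, ha.2, smul_zero]⟩

/-- The forms `d_θ η` with `η` a smooth `k`-form. -/
def twistedCoboundaries (θ : DiffForm E M 1) (k : ℕ) : Submodule ℝ (DiffForm E M (k + 1)) where
  carrier := {α | ∃ η : DiffForm E M k, IsSmoothForm η ∧ twistedD θ η = α}
  zero_mem' := ⟨0, .zero, by simpa using twistedD_smul θ 0 (0 : DiffForm E M k)⟩
  add_mem' := by
    rintro _ _ ⟨a, ha, rfl⟩ ⟨b, hb, rfl⟩
    exact ⟨a + b, ha.add hb, twistedD_add θ ha hb⟩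
  smul_mem' := by
    rintro c _ ⟨a, ha, rfl⟩
    exact ⟨c • a, ha.smul c, twistedD_smul θ c a⟩

/-- The `d_θ`-cohomology `H_θ^{k+1}(M)`. -/
abbrev TwistedCohomology (θ : DiffForm E M 1) (k : ℕ) : Type _ :=
  twistedCocycles θ (k + 1) ⧸
    (twistedCoboundaries θ k).comap (twistedCocycles θ (k + 1)).subtype

/-- The class `[α]_θ ∈ H_θ^{k+1}(M)` of a smooth `d_θ`-closed form `α`. -/
def twistedClass (θ : DiffForm E M 1) {k : ℕ} (α : DiffForm E M (k + 1))
    (hα : α ∈ twistedCocycles θ (k + 1)) : TwistedCohomology θ k :=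
  Submodule.Quotient.mk ⟨α, hα⟩

/-- `ω` is a locally conformal symplectic form with Lee form `θ`. -/
structure IsLCS (ω : DiffForm E M 2) (θ : DiffForm E M 1) : Prop where
  smooth : IsSmoothForm ω
  nondegenerate : ∀ (x : M) (v : TangentSpace 𝓘(ℝ, E) x), (∀ w, ω x ![v, w] = 0) → v = 0
  smooth_lee : IsSmoothForm θ
  closed_lee : extd θ = 0
  extd_eq : extd ω = wedge θ ω

theorem IsLCS.mem_twistedCocycles {ω : DiffForm E M 2} {θ : DiffForm E M 1} (h : IsLCS ω θ) :
    ω ∈ twistedCocycles θ 2 :=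
  ⟨h.smooth, by rw [twistedD, h.extd_eq, sub_self]⟩

/-- A form on a Lie group is left-invariant if `L_g^* α = α` for all `g`. -/
def IsLeftInvariant [Mul M] {k : ℕ} (α : DiffForm E M k) : Prop :=
  ∀ g : M, pullback (fun x : M => g * x) α = α

end Forms

/-! ### The group `ℝ^m ⋉_φ ℝ^n` -/

variable {m n : ℕ}

/-- The linear action of `ℝ^m` on `ℝ^n` given by a continuous homomorphism
`φ : ℝ^m → GL(n, ℝ)`. -/
def actionRep (φ : Multiplicative (Fin m → ℝ) →ₜ* GL (Fin n) ℝ) :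
    Representation ℝ (Multiplicative (Fin m → ℝ)) (Fin n → ℝ) :=
  (Matrix.toLinAlgEquiv' : Matrix (Fin n) (Fin n) ℝ ≃ₐ[ℝ] _).toAlgHom.toMonoidHom.comp
    ((Units.coeHom (Matrix (Fin n) (Fin n) ℝ)).comp φ.toMonoidHom)

/-- The Lie group `ℝ^m ⋉_φ ℝ^n`, with underlying manifold `ℝ^m × ℝ^n`. -/
def SemidirectRn (_φ : Multiplicative (Fin m → ℝ) →ₜ* GL (Fin n) ℝ) : Type :=
  (Fin m → ℝ) × (Fin n → ℝ)

namespace SemidirectRn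

variable (φ : Multiplicative (Fin m → ℝ) →ₜ* GL (Fin n) ℝ)

instance : TopologicalSpace (SemidirectRn φ) :=
  inferInstanceAs (TopologicalSpace ((Fin m → ℝ) × (Fin n → ℝ)))

instance : ChartedSpace ((Fin m → ℝ) × (Fin n → ℝ)) (SemidirectRn φ) :=
  chartedSpaceSelf ((Fin m → ℝ) × (Fin n → ℝ))

instance : IsManifold 𝓘(ℝ, (Fin m → ℝ) × (Fin n → ℝ)) ((⊤ : ℕ∞) : WithTop ℕ∞) (SemidirectRn φ) :=
  instIsManifoldModelSpace

/-- `(a, x) (b, y) = (a + b, x + φ(a) y)`. -/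
instance : Mul (SemidirectRn φ) :=
  ⟨fun g h => (g.1 + h.1, g.2 + actionRep φ (.ofAdd g.1) h.2)⟩

instance : One (SemidirectRn φ) := ⟨((0 : Fin m → ℝ), (0 : Fin n → ℝ))⟩

instance : Inv (SemidirectRn φ) := ⟨fun g => (-g.1, -actionRep φ (.ofAdd (-g.1)) g.2)⟩

variable {φ}

@[simp]
theorem mul_fst (g h : SemidirectRn φ) : (g * h).1 = g.1 + h.1 := rfl

@[simp]
theorem mul_snd (g h : SemidirectRn φ) :
    (g * h).2 = g.2 + actionRep φ (.ofAdd g.1) h.2 := rfl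

@[simp]
theorem one_fst : (1 : SemidirectRn φ).1 = 0 := rfl

@[simp]
theorem one_snd : (1 : SemidirectRn φ).2 = 0 := rfl

@[simp]
theorem inv_fst (g : SemidirectRn φ) : g⁻¹.1 = -g.1 := rfl

@[simp]
theorem inv_snd (g : SemidirectRn φ) : g⁻¹.2 = -actionRep φ (.ofAdd (-g.1)) g.2 := rfl

theorem actionRep_zero (x : Fin n → ℝ) : actionRep φ (.ofAdd 0) x = x := by
  rw [ofAdd_zero, map_one]
  rfl

theorem actionRep_add (a b : Fin m → ℝ) (x : Fin n → ℝ) :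
    actionRep φ (.ofAdd (a + b)) x = actionRep φ (.ofAdd a) (actionRep φ (.ofAdd b) x) := by
  rw [ofAdd_add, map_mul]
  rfl

variable (φ)

instance : Group (SemidirectRn φ) :=
  Group.ofLeftAxioms
    (fun a b c => Prod.ext (add_assoc _ _ _) (by
      simp only [mul_fst, mul_snd, actionRep_add, map_add, add_assoc]))
    (fun a => Prod.ext (zero_add _) (by
      simp only [mul_snd, one_fst, one_snd, actionRep_zero, zero_add]))
    (fun a => Prod.ext (neg_add_cancel _) (by
      simp only [mul_snd, inv_fst, inv_snd, one_snd, neg_add_cancel]))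

instance : IsTopologicalGroup (SemidirectRn φ) := by
  have hrep : ∀ (a : Fin m → ℝ) (x : Fin n → ℝ),
      actionRep φ (.ofAdd a) x = (φ (.ofAdd a) : Matrix (Fin n) (Fin n) ℝ).mulVec x :=
    fun _ _ => rfl
  have hφ : Continuous fun a : Fin m → ℝ =>
      (φ (.ofAdd a) : Matrix (Fin n) (Fin n) ℝ) :=
    Units.continuous_val.comp (φ.continuous_toFun.comp continuous_ofAdd)
  have h1 : Continuous (fun g : SemidirectRn φ => g.1) :=
    continuous_fst (X := Fin m → ℝ) (Y := Fin n → ℝ)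
  have h2 : Continuous (fun g : SemidirectRn φ => g.2) :=
    continuous_snd (X := Fin m → ℝ) (Y := Fin n → ℝ)
  have hmul : Continuous fun p : SemidirectRn φ × SemidirectRn φ => p.1 * p.2 := by
    change Continuous fun p : SemidirectRn φ × SemidirectRn φ =>
      ((p.1.1 + p.2.1, p.1.2 + actionRep φ (.ofAdd p.1.1) p.2.2) : (Fin m → ℝ) × (Fin n → ℝ))
    refine Continuous.prodMk ((h1.comp continuous_fst).add (h1.comp continuous_snd)) ?_
    refine (h2.comp continuous_fst).add ?_
    simp only [hrep]
    exact (hφ.comp (h1.comp continuous_fst)).matrix_mulVec (h2.comp continuous_snd)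
  have hinv : Continuous fun g : SemidirectRn φ => g⁻¹ := by
    change Continuous fun g : SemidirectRn φ =>
      ((-g.1, -actionRep φ (.ofAdd (-g.1)) g.2) : (Fin m → ℝ) × (Fin n → ℝ))
    refine Continuous.prodMk h1.neg ?_
    simp only [hrep]
    exact ((hφ.comp h1.neg).matrix_mulVec h2).neg
  exact { continuous_mul := hmul, continuous_inv := hinv }

theorem fst_eq_zero_of_mem_commutator {g : SemidirectRn φ}
    (hg : g ∈ commutator (SemidirectRn φ)) : g.1 = 0 := by
  let π : SemidirectRn φ →* Multiplicative (Fin m → ℝ) :=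
    { toFun := fun g => .ofAdd g.1
      map_one' := rfl
      map_mul' := fun _ _ => rfl }
  exact Abelianization.commutator_subset_ker π hg

/-- The commutator subgroup `[G, G]` of `G = ℝ^m ⋉_φ ℝ^n`, which is a linear subspace of
`ℝ^m × ℝ^n` (contained in `0 × ℝ^n`); its dimension is `dim [G, G]`. -/
def commutatorSubspace : Submodule ℝ ((Fin m → ℝ) × (Fin n → ℝ)) where
  carrier := {g | (show SemidirectRn φ from g) ∈ commutator (SemidirectRn φ)}
  zero_mem' := one_mem (commutator (SemidirectRn φ))
  add_mem' := by
    intro g h hg hh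
    have h1 : (show SemidirectRn φ from g) * (show SemidirectRn φ from h) = g + h := by
      have h0 : g.1 = 0 := fst_eq_zero_of_mem_commutator φ hg
      refine Prod.ext rfl ?_
      change g.2 + actionRep φ (.ofAdd g.1) h.2 = g.2 + h.2
      rw [h0, actionRep_zero]
    have h2 := mul_mem (show (show SemidirectRn φ from g) ∈ commutator (SemidirectRn φ) from hg) hh
    rw [h1] at h2
    exact h2
  smul_mem' := by
    intro c g hg
    let σ : SemidirectRn φ →* SemidirectRn φ :=
      { toFun := fun x => ((x.1, c • x.2) : (Fin m → ℝ) × (Fin n → ℝ))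
        map_one' := Prod.ext rfl (smul_zero c)
        map_mul' := fun x y => Prod.ext rfl (by
          change c • (x.2 + actionRep φ (.ofAdd x.1) y.2) =
            c • x.2 + actionRep φ (.ofAdd x.1) (c • y.2)
          rw [smul_add, map_smul]) }
    have h0 : g.1 = 0 := fst_eq_zero_of_mem_commutator φ hg
    have h1 : σ g = c • g :=
      Prod.ext (by change g.1 = c • g.1; rw [h0, smul_zero]) rfl
    have h2 : σ g ∈ commutator (SemidirectRn φ) := by
      have h3 : (commutator (SemidirectRn φ)).map σ ≤ commutator (SemidirectRn φ) := by
        rw [commutator_def, Subgroup.map_commutator]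
        exact Subgroup.commutator_mono le_top le_top
      exact h3 ⟨g, hg, rfl⟩
    rw [h1] at h2
    exact h2

variable {φ}

/-- Left translations of `ℝ^m ⋉_φ ℝ^n` are smooth (they are affine). -/
theorem contDiff_mul_left (g : SemidirectRn φ) :
    ContDiff ℝ ((⊤ : ℕ∞) : WithTop ℕ∞) (E := (Fin m → ℝ) × (Fin n → ℝ))
      (F := (Fin m → ℝ) × (Fin n → ℝ)) (fun x : SemidirectRn φ => g * x) := by
  change ContDiff ℝ ((⊤ : ℕ∞) : WithTop ℕ∞) fun x : (Fin m → ℝ) × (Fin n → ℝ) =>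
    (g.1 + x.1, g.2 + LinearMap.toContinuousLinearMap (actionRep φ (.ofAdd g.1)) x.2)
  fun_prop

/-- The space `Γ\G` of orbits of the left multiplication action of a subgroup `Γ` on `G`. -/
def LeftQuotient (Γ : Subgroup (SemidirectRn φ)) : Type :=
  MulAction.orbitRel.Quotient Γ (SemidirectRn φ)

instance (Γ : Subgroup (SemidirectRn φ)) : TopologicalSpace (LeftQuotient Γ) :=
  inferInstanceAs (TopologicalSpace (Quotient (MulAction.orbitRel Γ (SemidirectRn φ))))

/-- The projection `G → Γ\G`. -/
def proj (Γ : Subgroup (SemidirectRn φ)) (g : SemidirectRn φ) : LeftQuotient Γ :=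
  Quotient.mk (MulAction.orbitRel Γ (SemidirectRn φ)) g

/-- A lattice in `G`: a discrete subgroup with compact quotient. -/
class IsLattice (Γ : Subgroup (SemidirectRn φ)) : Prop where
  discrete : DiscreteTopology Γ
  compact : CompactSpace (LeftQuotient Γ)

section Lattice

variable (Γ : Subgroup (SemidirectRn φ)) [IsLattice Γ]

theorem isLocalHomeomorph_proj : IsLocalHomeomorph (proj Γ) := by
  have := IsLattice.discrete (Γ := Γ)
  have hq : Topology.IsQuotientMap (proj Γ) := isQuotientMap_quotient_mk'
  refine (hq.isQuotientCoveringMap_of_subgroup Γ ⟨this⟩ ?_).isCoveringMap.isLocalHomeomorph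
  intro g h
  exact Quotient.eq''.trans QuotientGroup.rightRel_apply

/-- A local inverse of the projection `G → Γ\G`, defined near `q`. -/
def localSection (q : LeftQuotient Γ) :
    OpenPartialHomeomorph (LeftQuotient Γ) (SemidirectRn φ) :=
  (isLocalHomeomorph_proj Γ (Quotient.out q)).choose.symm

theorem mem_localSection_source (q : LeftQuotient Γ) : q ∈ (localSection Γ q).source := by
  have h := (isLocalHomeomorph_proj Γ (Quotient.out q)).choose_spec
  have h2 := OpenPartialHomeomorph.map_source _ h.1
  rw [← h.2] at h2
  have h3 : proj Γ (Quotient.out q) = q := Quotient.out_eq q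
  rw [h3] at h2
  exact h2

theorem proj_eq_localSection_symm (q : LeftQuotient Γ) : proj Γ = (localSection Γ q).symm :=
  (isLocalHomeomorph_proj Γ (Quotient.out q)).choose_spec.2

/-- The smooth structure of `Γ\G`: the charts are local inverses of the projection `G → Γ\G`. -/
instance : ChartedSpace ((Fin m → ℝ) × (Fin n → ℝ)) (LeftQuotient Γ) where
  atlas := Set.range (localSection Γ)
  chartAt := localSection Γ
  mem_chart_source := mem_localSection_source Γ
  chart_mem_atlas q := ⟨q, rfl⟩

/-- The transition maps of the charts of `Γ\G` are locally left translations. -/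
theorem localSection_transition (p q : LeftQuotient Γ) (x : SemidirectRn φ)
    (hx : x ∈ ((localSection Γ p).symm.trans (localSection Γ q)).source) :
    ∃ γ : SemidirectRn φ, (fun x => localSection Γ q ((localSection Γ p).symm x)) =ᶠ[𝓝 x]
      fun x => γ * x := by
  have ho := ((localSection Γ p).symm.trans (localSection Γ q)).open_source.mem_nhds hx
  have ht := (localSection Γ q).open_target
  have hp : ∀ y ∈ ((localSection Γ p).symm.trans (localSection Γ q)).source,
      proj Γ (localSection Γ q ((localSection Γ p).symm y)) = proj Γ y := by
    intro y hy
    rw [OpenPartialHomeomorph.trans_source] at hy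
    rw [proj_eq_localSection_symm Γ q, (localSection Γ q).left_inv hy.2,
      ← proj_eq_localSection_symm Γ q, proj_eq_localSection_symm Γ p]
  have hm : ∀ y ∈ ((localSection Γ p).symm.trans (localSection Γ q)).source,
      localSection Γ q ((localSection Γ p).symm y) ∈ (localSection Γ q).target := by
    intro y hy
    rw [OpenPartialHomeomorph.trans_source] at hy
    exact (localSection Γ q).map_source hy.2
  obtain ⟨γ, hγ⟩ := (MulAction.orbitRel_apply (G := Γ)).1 (Quotient.exact (hp x hx))
  have hγ' : (γ : SemidirectRn φ) * x = localSection Γ q ((localSection Γ p).symm x) := hγ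
  have hL : ContinuousAt (fun y : SemidirectRn φ => (γ : SemidirectRn φ) * y) x :=
    (continuous_const_mul _).continuousAt
  have hL' : ∀ᶠ y in 𝓝 x, (γ : SemidirectRn φ) * y ∈ (localSection Γ q).target :=
    hL.eventually_mem (ht.mem_nhds (by simpa only [hγ'] using hm x hx))
  refine ⟨γ, ?_⟩
  filter_upwards [ho, hL'] with y hy hy'
  refine (localSection Γ q).symm.injOn (hm y hy) hy' ?_
  rw [← proj_eq_localSection_symm Γ q, hp y hy]
  exact Quotient.sound ((MulAction.orbitRel_apply (G := Γ)).2
    ⟨γ⁻¹, inv_mul_cancel_left (γ : SemidirectRn φ) y⟩)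

instance : IsManifold 𝓘(ℝ, (Fin m → ℝ) × (Fin n → ℝ)) ((⊤ : ℕ∞) : WithTop ℕ∞) (LeftQuotient Γ) := by
  refine isManifold_of_contDiffOn _ _ _ ?_
  rintro _ _ ⟨p, rfl⟩ ⟨q, rfl⟩
  simp only [modelWithCornersSelf_coe, modelWithCornersSelf_coe_symm, Function.comp_id,
    Function.id_comp, Set.range_id, Set.inter_univ, Set.preimage_id]
  intro x hx
  obtain ⟨γ, hγ⟩ := localSection_transition Γ p q x hx
  refine ContDiffAt.contDiffWithinAt (ContDiffAt.congr_of_eventuallyEq ?_ hγ)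
  exact (contDiff_mul_left γ).contDiffAt

end Lattice

end SemidirectRn

end LCSForms

end

/-!
Write `G = ℝ^m ⋉_φ ℝ^n`, and suppose that `ω = d_θ η` for a smooth `1`-form `η` on `Γ\G`. Then
`[G, G]` is an isotropic subspace for the nondegenerate form `ω` at the identity, so that
`2 dim [G, G] ≤ dim G` (`two_mul_finrank_le_of_isotropic`), contrary to the assumption on the
dimensions. The isotropy (`lift_zero_eq_zero_of_twistedD_eq`) comes from three facts.

* The Lee form vanishes on `[G, G]` (`lift_zero_eq_zero_of_mem_commutator`): being closed and
  left-invariant, it defines a homomorphism from `G` to the abelian group `ℝ`.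
* `[G, G]` lies in the abelian group `0 × ℝ^n`, whose elements translate `G` without changing
  directions in `0 × ℝ^n`. Hence for `X, Y ∈ [G, G]` the equation `ω = dη - θ ∧ η` on the plane
  spanned by `X` and `Y` reads `ω(X, Y) = ∂_X η(Y) - ∂_Y η(X)`, with a constant left-hand side.
* The functions `η(X)` and `η(Y)` on this plane are bounded, because `Γ\G` is compact
  (`exists_forall_abs_lift_leftDeriv_le`). A constant that is the divergence of a bounded vector
  field on the plane is zero, by Stokes' theorem on large squares
  (`eq_zero_of_bounded_of_divergence_eq`); no averaging of `η` over `Γ\G` is needed.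

Forms on `Γ\G` are handled through their pullbacks `lift Γ α` to the vector space `ℝ^m × ℝ^n`. Since
the charts of `Γ\G` are local inverses of the projection, `lift Γ α` is the expression of `α` in
every chart; its invariance under `Γ` carries statements from the base points of the charts to all
of `G` (`contDiff_lift`, `lift_extd`).
-/

noncomputable section

namespace LCSForms

/-! ### Bounded primitives of constant forms on the plane -/

/-- If the divergence `∂₁f + ∂₂g` of a bounded `C¹` vector field on the plane is a constant `c`,
then `c = 0`: on a square of side `R`, the integral `c R²` of the divergence equals a boundary term
of size `O(R)`. -/
theorem eq_zero_of_bounded_of_divergence_eq {f g : ℝ × ℝ → ℝ} (hf : ContDiff ℝ 1 f)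
    (hg : ContDiff ℝ 1 g) {C D c : ℝ} (hfC : ∀ x, |f x| ≤ C) (hgD : ∀ x, |g x| ≤ D)
    (h : ∀ x, fderiv ℝ f x (1, 0) + fderiv ℝ g x (0, 1) = c) : c = 0 := by
  have key : ∀ R : ℝ, 0 < R → |c| * R ≤ 2 * (C + D) := by
    intro R hR
    have hd := MeasureTheory.integral2_divergence_prod_of_hasFDerivAt f g (fderiv ℝ f) (fderiv ℝ g)
      0 0 R R hf.continuous.continuousOn hg.continuous.continuousOn
      (fun x _ => (hf.differentiable one_ne_zero x).hasFDerivAt)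
      (fun x _ => (hg.differentiable one_ne_zero x).hasFDerivAt)
      (by
        simp only [h]
        exact continuousOn_const.integrableOn_compact (isCompact_uIcc.prod isCompact_uIcc))
    simp only [h, intervalIntegral.integral_const, sub_zero, smul_eq_mul] at hd
    have hb : ∀ {u : ℝ → ℝ} {B : ℝ}, (∀ t, |u t| ≤ B) → |∫ t in (0 : ℝ)..R, u t| ≤ B * R := by
      intro u B hu
      have := intervalIntegral.norm_integral_le_of_norm_le_const (a := (0 : ℝ)) (b := R) (f := u)
        (C := B) (fun t _ => hu t)
      rwa [sub_zero, abs_of_pos hR] at this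
    have b1 := abs_le.1 (hb fun t => hgD (t, R))
    have b2 := abs_le.1 (hb fun t => hgD (t, 0))
    have b3 := abs_le.1 (hb fun t => hfC (R, t))
    have b4 := abs_le.1 (hb fun t => hfC (0, t))
    have hs : |R * (R * c)| ≤ 2 * (C + D) * R := by
      rw [hd, abs_le]
      constructor <;> linarith [b1.1, b1.2, b2.1, b2.2, b3.1, b3.2, b4.1, b4.2]
    rw [abs_mul, abs_mul, abs_of_pos hR] at hs
    exact le_of_mul_le_mul_right (by linarith) hR
  by_contra hc
  have hc' : 0 < |c| := abs_pos.2 hc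
  have hCD : 0 ≤ C + D :=
    add_nonneg ((abs_nonneg _).trans (hfC 0)) ((abs_nonneg _).trans (hgD 0))
  have h1 := key ((2 * (C + D) + 1) / |c|) (by positivity)
  rw [mul_div_cancel₀ _ hc'.ne'] at h1
  linarith

/-! ### Isotropic subspaces -/

/-- A subspace on which a nondegenerate alternating form vanishes has at most half the dimension. -/
theorem two_mul_finrank_le_of_isotropic {V : Type*} [NormedAddCommGroup V] [NormedSpace ℝ V]
    [FiniteDimensional ℝ V] (ω : V [⋀^Fin 2]→L[ℝ] ℝ) (hω : ∀ v, (∀ w, ω ![v, w] = 0) → v = 0)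
    (W : Submodule ℝ V) (hW : ∀ v ∈ W, ∀ w ∈ W, ω ![v, w] = 0) :
    2 * Module.finrank ℝ W ≤ Module.finrank ℝ V := by
  have hup : ∀ a b : V, ![a, b] = Function.update ![a, 0] 1 b := fun a b => by
    funext i
    fin_cases i <;> rfl
  let B : V →ₗ[ℝ] V →ₗ[ℝ] ℝ := LinearMap.mk₂ ℝ (fun v w => ω ![v, w])
    (fun a b w => by simpa using ω.map_vecCons_add ![w] a b)
    (fun c a w => by simpa using ω.map_vecCons_smul ![w] c a)
    (fun a b c => by
      rw [hup a (b + c), hup a b, hup a c]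
      exact ω.map_update_add ![a, 0] 1 b c)
    (fun c a b => by
      rw [hup a (c • b), hup a b]
      exact ω.map_update_smul ![a, 0] 1 c b)
  have hinj : Function.Injective B := by
    rw [injective_iff_map_eq_zero]
    exact fun v hv => hω v fun w => LinearMap.congr_fun hv w
  -- `v ↦ ω(v, ·)` embeds `W` into the annihilator of `W`.
  have hle : W.map B ≤ W.dualAnnihilator := by
    rintro _ ⟨v, hv, rfl⟩
    rw [Submodule.mem_dualAnnihilator]
    exact fun w hw => hW v hv w hw
  have h1 : Module.finrank ℝ W ≤ Module.finrank ℝ W.dualAnnihilator :=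
    (Submodule.equivMapOfInjective B hinj W).finrank_eq.trans_le (Submodule.finrank_mono hle)
  have h2 := Subspace.finrank_add_finrank_dualAnnihilator_eq W
  omega

namespace SemidirectRn

variable {m n : ℕ} {φ : Multiplicative (Fin m → ℝ) →ₜ* GL (Fin n) ℝ}

/-! ### Left translations -/

/-- The derivative of the left translation by an element `(a, x)`: the linear map
`(b, y) ↦ (b, φ(a) y)`. It depends on `a` only and is the same at every point. -/
def leftDeriv (φ : Multiplicative (Fin m → ℝ) →ₜ* GL (Fin n) ℝ) (a : Fin m → ℝ) :
    ((Fin m → ℝ) × (Fin n → ℝ)) →L[ℝ] ((Fin m → ℝ) × (Fin n → ℝ)) :=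
  (ContinuousLinearMap.id ℝ (Fin m → ℝ)).prodMap
    (LinearMap.toContinuousLinearMap (actionRep φ (.ofAdd a)))

@[simp]
theorem leftDeriv_apply (a : Fin m → ℝ) (v : (Fin m → ℝ) × (Fin n → ℝ)) :
    leftDeriv φ a v = (v.1, actionRep φ (.ofAdd a) v.2) := rfl

theorem hasFDerivAt_mul_left (g x : SemidirectRn φ) :
    HasFDerivAt (E := (Fin m → ℝ) × (Fin n → ℝ)) (F := (Fin m → ℝ) × (Fin n → ℝ))
      (fun x : SemidirectRn φ => g * x) (leftDeriv φ g.1) x := by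
  have h := ((leftDeriv φ g.1).hasFDerivAt (x := x)).const_add
    (show (Fin m → ℝ) × (Fin n → ℝ) from g)
  exact h

/-- The left translation by `g`, as a map of the vector space `ℝ^m × ℝ^n` underlying `G`. -/
def leftMul (g : SemidirectRn φ) (x : (Fin m → ℝ) × (Fin n → ℝ)) : (Fin m → ℝ) × (Fin n → ℝ) :=
  (show SemidirectRn φ from g * (show SemidirectRn φ from x))

theorem contDiff_leftMul (g : SemidirectRn φ) :
    ContDiff ℝ ((⊤ : ℕ∞) : WithTop ℕ∞) (leftMul g) :=
  contDiff_mul_left g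

theorem fderiv_leftMul (g : SemidirectRn φ) (x : (Fin m → ℝ) × (Fin n → ℝ)) :
    fderiv ℝ (leftMul g) x = leftDeriv φ g.1 :=
  (hasFDerivAt_mul_left g x).fderiv

theorem hasMFDerivAt_mul_left (g x : SemidirectRn φ) :
    HasMFDerivAt 𝓘(ℝ, (Fin m → ℝ) × (Fin n → ℝ)) 𝓘(ℝ, (Fin m → ℝ) × (Fin n → ℝ))
      (fun x : SemidirectRn φ => g * x) x (leftDeriv φ g.1) :=
  (hasFDerivAt_mul_left g x).hasMFDerivAt

theorem continuous_leftDeriv_apply (v : (Fin m → ℝ) × (Fin n → ℝ)) :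
    Continuous fun a : Fin m → ℝ => leftDeriv φ a v := by
  have hφ : Continuous fun a : Fin m → ℝ => (φ (.ofAdd a) : Matrix (Fin n) (Fin n) ℝ) :=
    Units.continuous_val.comp (φ.continuous_toFun.comp continuous_ofAdd)
  exact continuous_const.prodMk (hφ.matrix_mulVec continuous_const)

/-! ### Forms on the quotient and their lifts to the group -/

theorem proj_mul_of_mem (Γ : Subgroup (SemidirectRn φ)) {γ : SemidirectRn φ} (hγ : γ ∈ Γ)
    (g : SemidirectRn φ) : proj Γ (γ * g) = proj Γ g :=
  Quotient.sound ((MulAction.orbitRel_apply (G := Γ)).2 ⟨⟨γ, hγ⟩, rfl⟩)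

variable (Γ : Subgroup (SemidirectRn φ)) [IsLattice Γ] {k : ℕ}

/-- The pullback of a form on `Γ\G` to `G`, as a form on the vector space `ℝ^m × ℝ^n`. -/
def lift (α : DiffForm ((Fin m → ℝ) × (Fin n → ℝ)) (LeftQuotient Γ) k) :
    (Fin m → ℝ) × (Fin n → ℝ) → ((Fin m → ℝ) × (Fin n → ℝ)) [⋀^Fin k]→L[ℝ] ℝ :=
  fun g => pullback (M := SemidirectRn φ) (proj Γ) α g

/-- The projection is the inverse of every chart of `Γ\G`, so in each chart a form is
represented by its lift. -/
theorem inChart_chartAt (α : DiffForm ((Fin m → ℝ) × (Fin n → ℝ)) (LeftQuotient Γ) k)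
    (q : LeftQuotient Γ) :
    inChart (chartAt ((Fin m → ℝ) × (Fin n → ℝ)) q) α = lift Γ α := by
  change (fun y : SemidirectRn φ => pullback (M := SemidirectRn φ) (localSection Γ q).symm α y) = _
  rw [← proj_eq_localSection_symm Γ q]
  rfl

theorem proj_localSection (q : LeftQuotient Γ) : proj Γ (localSection Γ q q) = q := by
  rw [proj_eq_localSection_symm Γ q]
  exact (localSection Γ q).left_inv (mem_localSection_source Γ q)

/-- Every point of `G` is a `Γ`-translate of the base point of one of the charts of `Γ\G`. -/
theorem exists_mem_mul_eq_localSection (g : SemidirectRn φ) :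
    ∃ γ ∈ Γ, γ * g = localSection Γ (proj Γ g) (proj Γ g) := by
  obtain ⟨γ, hγ⟩ := (MulAction.orbitRel_apply (G := Γ)).1
    (Quotient.exact (proj_localSection Γ (proj Γ g)))
  exact ⟨γ, γ.2, hγ⟩

theorem mdifferentiableAt_proj (g : SemidirectRn φ) :
    MDifferentiableAt 𝓘(ℝ, (Fin m → ℝ) × (Fin n → ℝ)) 𝓘(ℝ, (Fin m → ℝ) × (Fin n → ℝ))
      (proj Γ) g := by
  obtain ⟨γ, hγ, h⟩ := exists_mem_mul_eq_localSection Γ g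
  have h1 : MDifferentiableAt 𝓘(ℝ, (Fin m → ℝ) × (Fin n → ℝ)) 𝓘(ℝ, (Fin m → ℝ) × (Fin n → ℝ))
      (proj Γ) (γ * g) := by
    rw [h]
    generalize proj Γ g = q
    rw [proj_eq_localSection_symm Γ q]
    exact mdifferentiableAt_atlas_symm (I := 𝓘(ℝ, (Fin m → ℝ) × (Fin n → ℝ)))
      (chart_mem_atlas ((Fin m → ℝ) × (Fin n → ℝ)) q)
      (mem_chart_target ((Fin m → ℝ) × (Fin n → ℝ)) q)
  have h2 := h1.comp g (hasMFDerivAt_mul_left γ g).mdifferentiableAt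
  have h3 : proj Γ ∘ (fun x => γ * x) = proj Γ := funext fun x => proj_mul_of_mem Γ hγ x
  rwa [h3] at h2

/-- Tangent vectors of `Γ\G` at `q` are encoded through the chart at `q`, so the derivative of
this chart at `q` is the identity of `ℝ^m × ℝ^n`. -/
theorem mfderiv_chartAt_self (q : LeftQuotient Γ) :
    (mfderiv 𝓘(ℝ, (Fin m → ℝ) × (Fin n → ℝ)) 𝓘(ℝ, (Fin m → ℝ) × (Fin n → ℝ))
      (chartAt ((Fin m → ℝ) × (Fin n → ℝ)) q) q :
      ((Fin m → ℝ) × (Fin n → ℝ)) →L[ℝ] ((Fin m → ℝ) × (Fin n → ℝ))) = .id ℝ _ := by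
  have : IsManifold 𝓘(ℝ, (Fin m → ℝ) × (Fin n → ℝ)) 1 (LeftQuotient Γ) :=
    .of_le (n := ((⊤ : ℕ∞) : WithTop ℕ∞)) (by simp)
  have h := mfderiv_extChartAt_self (I := 𝓘(ℝ, (Fin m → ℝ) × (Fin n → ℝ))) (x := q)
  simp only [mfld_simps] at h
  exact h

/-- The projection inverts the chart at `q`, so its derivative at the base point of this chart is
the identity as well. -/
theorem mfderiv_proj_localSection (q : LeftQuotient Γ) :
    (mfderiv 𝓘(ℝ, (Fin m → ℝ) × (Fin n → ℝ)) 𝓘(ℝ, (Fin m → ℝ) × (Fin n → ℝ))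
      (proj Γ) (localSection Γ q q) :
      ((Fin m → ℝ) × (Fin n → ℝ)) →L[ℝ] ((Fin m → ℝ) × (Fin n → ℝ))) = .id ℝ _ := by
  have hM : IsManifold 𝓘(ℝ, (Fin m → ℝ) × (Fin n → ℝ)) 1 (LeftQuotient Γ) :=
    .of_le (n := ((⊤ : ℕ∞) : WithTop ℕ∞)) (by simp)
  -- `localSection Γ q` has to be differentiated at `(localSection Γ q).symm (localSection Γ q q)`,
  -- which equals `q` only propositionally.
  have h0 : ∀ p : LeftQuotient Γ, p = q →
      (mfderiv 𝓘(ℝ, (Fin m → ℝ) × (Fin n → ℝ)) 𝓘(ℝ, (Fin m → ℝ) × (Fin n → ℝ))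
        (localSection Γ q) p :
        ((Fin m → ℝ) × (Fin n → ℝ)) →L[ℝ] ((Fin m → ℝ) × (Fin n → ℝ))) = .id ℝ _ := by
    rintro p rfl
    exact mfderiv_chartAt_self Γ p
  have h1 := (mdifferentiable_chart (I := 𝓘(ℝ, (Fin m → ℝ) × (Fin n → ℝ))) q).comp_symm_deriv
    (mem_chart_target ((Fin m → ℝ) × (Fin n → ℝ)) q)
  have h2 := h0 _ ((localSection Γ q).left_inv (mem_localSection_source Γ q))
  rw [proj_eq_localSection_symm Γ q]
  refine Eq.trans ?_ h1
  refine Eq.trans ?_ (congrArg (fun f : ((Fin m → ℝ) × (Fin n → ℝ)) →L[ℝ] _ =>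
    f.comp (mfderiv 𝓘(ℝ, (Fin m → ℝ) × (Fin n → ℝ)) 𝓘(ℝ, (Fin m → ℝ) × (Fin n → ℝ))
      (localSection Γ q).symm (localSection Γ q q) :
        ((Fin m → ℝ) × (Fin n → ℝ)) →L[ℝ] ((Fin m → ℝ) × (Fin n → ℝ)))) h2.symm)
  exact (ContinuousLinearMap.id_comp _).symm

/-- At the base point of the chart at `q`, the lift of a form takes the very value of the form at
`q`. -/
theorem lift_localSection (α : DiffForm ((Fin m → ℝ) × (Fin n → ℝ)) (LeftQuotient Γ) k)
    (q : LeftQuotient Γ) : lift Γ α (localSection Γ q q) = α q := by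
  have h : ∀ p : LeftQuotient Γ, p = q →
      ∀ v : Fin k → (Fin m → ℝ) × (Fin n → ℝ), α p v = α q v := by
    rintro p rfl v
    rfl
  refine ContinuousAlternatingMap.ext fun v => ?_
  change α (proj Γ (localSection Γ q q)) (fun i => mfderiv _ _ (proj Γ) (localSection Γ q q) (v i))
    = _
  have h2 : (fun i => mfderiv 𝓘(ℝ, (Fin m → ℝ) × (Fin n → ℝ)) 𝓘(ℝ, (Fin m → ℝ) × (Fin n → ℝ))
      (proj Γ) (localSection Γ q q) (v i)) = v := funext fun i =>
    congrArg (fun f : ((Fin m → ℝ) × (Fin n → ℝ)) →L[ℝ] ((Fin m → ℝ) × (Fin n → ℝ)) => f (v i))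
      (mfderiv_proj_localSection Γ q)
  rw [h2]
  exact h _ (proj_localSection Γ q) v

/-- The lift of a form on `Γ\G` is invariant under left translations by `Γ`. -/
theorem lift_mul_of_mem (α : DiffForm ((Fin m → ℝ) × (Fin n → ℝ)) (LeftQuotient Γ) k)
    {γ : SemidirectRn φ} (hγ : γ ∈ Γ) (g : SemidirectRn φ) :
    (lift Γ α (γ * g)).compContinuousLinearMap (leftDeriv φ γ.1) = lift Γ α g := by
  have h1 : pullback (M := SemidirectRn φ) (proj Γ ∘ fun x => γ * x) α g = lift Γ α g := by
    rw [show (proj Γ ∘ fun x => γ * x) = proj Γ from funext fun x => proj_mul_of_mem Γ hγ x]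
    rfl
  rw [← h1]
  refine ContinuousAlternatingMap.ext fun v => ?_
  have h2 := mfderiv_comp g (mdifferentiableAt_proj Γ (γ * g))
    (hasMFDerivAt_mul_left γ g).mdifferentiableAt
  rw [(hasMFDerivAt_mul_left γ g).mfderiv] at h2
  change _ = α (proj Γ (γ * g)) (fun i => mfderiv _ _ (proj Γ ∘ fun x => γ * x) g (v i))
  rw [h2]
  rfl

/-- The counterpart of `lift_mul_of_mem` for translations by all of `G`. -/
theorem lift_mul_of_isLeftInvariant {α : DiffForm ((Fin m → ℝ) × (Fin n → ℝ)) (LeftQuotient Γ) k}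
    (hα : IsLeftInvariant (pullback (proj Γ) α)) (g x : SemidirectRn φ) :
    (lift Γ α (g * x)).compContinuousLinearMap (leftDeriv φ g.1) = lift Γ α x := by
  have h := congrArg (fun β : DiffForm ((Fin m → ℝ) × (Fin n → ℝ)) (SemidirectRn φ) k => β x) (hα g)
  refine Eq.trans ?_ h
  refine ContinuousAlternatingMap.ext fun v => ?_
  change _ = pullback (proj Γ) α (g * x) (fun i => mfderiv _ _ (fun y => g * y) x (v i))
  rw [(hasMFDerivAt_mul_left g x).mfderiv]
  rfl

theorem contDiff_lift {α : DiffForm ((Fin m → ℝ) × (Fin n → ℝ)) (LeftQuotient Γ) k}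
    (hα : IsSmoothForm α) : ContDiff ℝ ((⊤ : ℕ∞) : WithTop ℕ∞) (lift Γ α) := by
  rw [contDiff_iff_contDiffAt]
  intro g
  obtain ⟨γ, hγ, h⟩ := exists_mem_mul_eq_localSection Γ g
  have h1 : ContDiffAt ℝ ((⊤ : ℕ∞) : WithTop ℕ∞) (lift Γ α) (leftMul γ g) := by
    rw [show leftMul γ g = localSection Γ (proj Γ g) (proj Γ g) from h]
    generalize proj Γ g = q
    have h2 := (hα q).contDiffAt ((chartAt ((Fin m → ℝ) × (Fin n → ℝ)) q).open_target.mem_nhds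
      (mem_chart_target ((Fin m → ℝ) × (Fin n → ℝ)) q))
    rwa [inChart_chartAt] at h2
  have h3 : lift Γ α = fun x =>
      ContinuousAlternatingMap.compContinuousLinearMapCLM (leftDeriv φ γ.1)
        (lift Γ α (leftMul γ x)) :=
    funext fun x => (lift_mul_of_mem Γ α hγ x).symm
  rw [h3]
  exact (ContinuousLinearMap.contDiff _).contDiffAt.comp _
    (h1.comp g (contDiff_leftMul γ).contDiffAt)

/-- Pulling back to `G` commutes with the exterior derivative. -/
theorem lift_extd {α : DiffForm ((Fin m → ℝ) × (Fin n → ℝ)) (LeftQuotient Γ) k}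
    (hα : IsSmoothForm α) (g : (Fin m → ℝ) × (Fin n → ℝ)) :
    lift Γ (extd α) g = extDeriv (lift Γ α) g := by
  obtain ⟨γ, hγ, h⟩ := exists_mem_mul_eq_localSection Γ g
  -- At the base point of a chart both sides are the same by definition of `extd`.
  have h1 : ∀ q, lift Γ (extd α) (localSection Γ q q) =
      extDeriv (lift Γ α) (localSection Γ q q) := by
    intro q
    rw [lift_localSection, ← inChart_chartAt Γ α q]
    refine ContinuousAlternatingMap.ext fun v => ?_
    change extDeriv (inChart (chartAt ((Fin m → ℝ) × (Fin n → ℝ)) q) α) _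
      (fun i => mfderiv _ _ (chartAt ((Fin m → ℝ) × (Fin n → ℝ)) q) q (v i)) = _
    congr 1
    exact funext fun i => congrArg (fun f : ((Fin m → ℝ) × (Fin n → ℝ)) →L[ℝ]
      ((Fin m → ℝ) × (Fin n → ℝ)) => f (v i)) (mfderiv_chartAt_self Γ q)
  -- Both sides are `Γ`-invariant.
  have h2 : lift Γ α = fun x =>
      (lift Γ α (leftMul γ x)).compContinuousLinearMap (fderiv ℝ (leftMul γ) x) :=
    funext fun x => by
      rw [fderiv_leftMul]
      exact (lift_mul_of_mem Γ α hγ x).symm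
  have h3 : extDeriv (lift Γ α) g =
      (extDeriv (lift Γ α) (leftMul γ g)).compContinuousLinearMap (leftDeriv φ γ.1) := by
    rw [← fderiv_leftMul γ g, ← extDeriv_pullback (r := ((⊤ : ℕ∞) : WithTop ℕ∞))
      ((contDiff_lift Γ hα).differentiable (by simp) _) (contDiff_leftMul γ).contDiffAt
      (by
        rw [minSmoothness_of_isRCLikeNormedField]
        exact WithTop.coe_le_coe.2 (le_top (a := (2 : ℕ∞)))), ← h2]
  rw [h3, show leftMul γ g = localSection Γ (proj Γ g) (proj Γ g) from h, ← h1, ← h]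
  exact (lift_mul_of_mem Γ (extd α) hγ g).symm

theorem lift_wedge (θ : DiffForm ((Fin m → ℝ) × (Fin n → ℝ)) (LeftQuotient Γ) 1)
    (α : DiffForm ((Fin m → ℝ) × (Fin n → ℝ)) (LeftQuotient Γ) k)
    (g : (Fin m → ℝ) × (Fin n → ℝ)) :
    lift Γ (wedge θ α) g = wedgeAlt (lift Γ θ g) (lift Γ α g) := by
  refine ContinuousAlternatingMap.ext fun v => ?_
  rw [wedgeAlt_apply]
  refine (wedgeAlt_apply (E := (Fin m → ℝ) × (Fin n → ℝ)) (θ (proj Γ g)) (α (proj Γ g)) _).trans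
    (Finset.sum_congr rfl fun i _ => ?_)
  congr 2
  change _ = θ (proj Γ g) _
  congr 1
  exact funext fun j => by rw [Subsingleton.elim j 0]; rfl

theorem lift_twistedD (θ : DiffForm ((Fin m → ℝ) × (Fin n → ℝ)) (LeftQuotient Γ) 1)
    {α : DiffForm ((Fin m → ℝ) × (Fin n → ℝ)) (LeftQuotient Γ) k} (hα : IsSmoothForm α)
    (g : (Fin m → ℝ) × (Fin n → ℝ)) :
    lift Γ (twistedD θ α) g = extDeriv (lift Γ α) g - wedgeAlt (lift Γ θ g) (lift Γ α g) := by
  rw [← lift_extd Γ hα, ← lift_wedge]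
  rfl

/-! ### Boundedness from compactness -/

/-- The coefficients of the lift of a form in a left-invariant frame are bounded: they descend to
continuous functions on the compact space `Γ\G`. -/
theorem exists_forall_abs_lift_leftDeriv_le
    {α : DiffForm ((Fin m → ℝ) × (Fin n → ℝ)) (LeftQuotient Γ) k} (hα : IsSmoothForm α)
    (v : Fin k → (Fin m → ℝ) × (Fin n → ℝ)) :
    ∃ C, ∀ g : SemidirectRn φ, |lift Γ α g (fun i => leftDeriv φ g.1 (v i))| ≤ C := by
  have := IsLattice.compact (Γ := Γ)
  let h : SemidirectRn φ → ℝ := fun g => lift Γ α g (fun i => leftDeriv φ g.1 (v i))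
  have hc : Continuous h := by
    have h1 : Continuous fun g : (Fin m → ℝ) × (Fin n → ℝ) => fun i => leftDeriv φ g.1 (v i) :=
      continuous_pi fun i => (continuous_leftDeriv_apply (v i)).comp continuous_fst
    exact (contDiff_lift Γ hα).continuous.eval h1
  have hinv : ∀ a b : SemidirectRn φ, MulAction.orbitRel Γ (SemidirectRn φ) a b → h a = h b := by
    intro a b hab
    obtain ⟨γ, rfl⟩ := (MulAction.orbitRel_apply (G := Γ)).1 hab
    change lift Γ α (γ.1 * b) (fun i => leftDeriv φ (γ.1.1 + b.1) (v i)) = h b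
    simp only [h, ← lift_mul_of_mem Γ α γ.2 b]
    rw [ContinuousAlternatingMap.compContinuousLinearMap_apply]
    congr 1
    exact funext fun i => Prod.ext rfl (actionRep_add _ _ _)
  let H : LeftQuotient Γ → ℝ := Quotient.lift h hinv
  have hH : Continuous H := hc.quotient_lift hinv
  obtain ⟨C, hC⟩ := (isCompact_range hH).isBounded.exists_norm_le
  exact ⟨C, fun g => hC _ ⟨proj Γ g, rfl⟩⟩

/-! ### The Lee form vanishes on the commutator subgroup -/

/-- A closed left-invariant `1`-form `θ` satisfies `θ(φ(a)y) = θ(y)` at the identity. Indeed, by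
left invariance the form at `(a, x)` takes the value `θ(φ(-a)y)` on `(0, y)` and `θ(b)` on `(b, 0)`,
so closedness says that `θ(φ(-a)y)` has derivative zero in `a`. -/
theorem lift_zero_actionRep {θ : DiffForm ((Fin m → ℝ) × (Fin n → ℝ)) (LeftQuotient Γ) 1}
    (hs : IsSmoothForm θ) (hd : extd θ = 0) (hθ : IsLeftInvariant (pullback (proj Γ) θ))
    (a : Fin m → ℝ) (y : Fin n → ℝ) :
    lift Γ θ 0 ![(0, actionRep φ (.ofAdd a) y)] = lift Γ θ 0 ![(0, y)] := by
  have hinv : ∀ (g v : (Fin m → ℝ) × (Fin n → ℝ)),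
      lift Γ θ g ![leftDeriv φ g.1 v] = lift Γ θ 0 ![v] := by
    intro g v
    have h1 := lift_mul_of_isLeftInvariant Γ hθ (show SemidirectRn φ from g) 1
    rw [mul_one] at h1
    have h2 := congrArg (fun β => β ![v]) h1
    refine Eq.trans ?_ h2
    change _ = lift Γ θ g (leftDeriv φ g.1 ∘ ![v])
    congr 1
    funext i
    fin_cases i
    rfl
  have hdiff := (contDiff_lift Γ hs).differentiable (by simp)
  have happ : ∀ w : (Fin m → ℝ) × (Fin n → ℝ), Differentiable ℝ fun g => lift Γ θ g ![w] :=
    fun w g => (hdiff g).continuousAlternatingMap_apply_const _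
  have hclosed : ∀ g b, fderiv ℝ (fun g => lift Γ θ g ![(0, y)]) g (b, 0) = 0 := by
    intro g b
    have h1 : extDeriv (lift Γ θ) g ![(b, 0), (0, y)] = 0 := by
      rw [← lift_extd Γ hs, hd]
      rfl
    rw [extDeriv_apply (hdiff g)] at h1
    have h2 : (fun g => lift Γ θ g ![(b, 0)]) = fun _ => lift Γ θ 0 ![(b, 0)] := by
      funext g
      have := hinv g (b, 0)
      rwa [leftDeriv_apply, map_zero] at this
    have e0 : Fin.removeNth (0 : Fin 2) ![((b, 0) : (Fin m → ℝ) × (Fin n → ℝ)), (0, y)] =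
        ![(0, y)] := by
      funext i; fin_cases i; rfl
    have e1 : Fin.removeNth (1 : Fin 2) ![((b, 0) : (Fin m → ℝ) × (Fin n → ℝ)), (0, y)] =
        ![(b, 0)] := by
      funext i; fin_cases i; rfl
    rw [Fin.sum_univ_two, e0, e1, h2] at h1
    simpa using h1
  -- Hence the coefficient of `(0, y)` does not change along `ℝ^m × 0`.
  have hconst : ∀ a : Fin m → ℝ, lift Γ θ (a, 0) ![(0, y)] = lift Γ θ (0, 0) ![(0, y)] := by
    intro a
    have hcomp : ∀ a : Fin m → ℝ, HasFDerivAt (fun a : Fin m → ℝ => lift Γ θ (a, 0) ![(0, y)])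
        ((fderiv ℝ (fun g => lift Γ θ g ![(0, y)]) (a, 0)).comp
          (ContinuousLinearMap.inl ℝ (Fin m → ℝ) (Fin n → ℝ))) a := fun a =>
      HasFDerivAt.comp (g := fun g => lift Γ θ g ![(0, y)]) a (happ (0, y) (a, 0)).hasFDerivAt
        (ContinuousLinearMap.inl ℝ (Fin m → ℝ) (Fin n → ℝ)).hasFDerivAt
    refine is_const_of_fderiv_eq_zero (fun a => (hcomp a).differentiableAt) (fun a => ?_) a 0
    rw [(hcomp a).fderiv]
    ext b
    exact hclosed _ _
  -- At `(-a, 0)` this coefficient is the value of the form at the identity on `φ(a)y`.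
  have h3 := hinv (-a, 0) (0, actionRep φ (.ofAdd a) y)
  rw [leftDeriv_apply] at h3
  simp only [← actionRep_add, neg_add_cancel, actionRep_zero] at h3
  rw [← h3, hconst (-a)]
  rfl

theorem lift_zero_eq_zero_of_mem_commutator
    {θ : DiffForm ((Fin m → ℝ) × (Fin n → ℝ)) (LeftQuotient Γ) 1}
    (hs : IsSmoothForm θ) (hd : extd θ = 0) (hθ : IsLeftInvariant (pullback (proj Γ) θ))
    {w : (Fin m → ℝ) × (Fin n → ℝ)} (hw : w ∈ commutatorSubspace φ) :
    lift Γ θ 0 ![w] = 0 := by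
  -- By invariance under `φ`, the form is a homomorphism from `G` to the abelian group `ℝ`.
  let F : SemidirectRn φ →* Multiplicative ℝ :=
    { toFun := fun g => .ofAdd (lift Γ θ 0 ![((0 : Fin m → ℝ), g.2)])
      map_one' := by
        rw [one_snd]
        exact congrArg Multiplicative.ofAdd ((lift Γ θ 0).map_coord_zero 0 rfl)
      map_mul' := fun g h => by
        rw [mul_snd, ← ofAdd_add, ← lift_zero_actionRep Γ hs hd hθ g.1 h.2]
        congr 1
        have := (lift Γ θ 0).map_vecCons_add ![] ((0 : Fin m → ℝ), g.2)
          ((0 : Fin m → ℝ), actionRep φ (.ofAdd g.1) h.2)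
        rwa [Prod.mk_add_mk, add_zero] at this }
  have h1 : F w = 1 := Abelianization.commutator_subset_ker F hw
  have h2 : w = (0, w.2) := Prod.ext (fst_eq_zero_of_mem_commutator φ hw) rfl
  rw [h2]
  exact congrArg Multiplicative.toAdd h1

/-! ### Exactness makes the commutator subgroup isotropic -/

/-- A left-invariant form has constant coefficients along `0 × ℝ^n`, as the left translations by
elements of this subgroup are translations of the vector space. -/
theorem lift_of_fst_eq_zero {α : DiffForm ((Fin m → ℝ) × (Fin n → ℝ)) (LeftQuotient Γ) k}
    (hα : IsLeftInvariant (pullback (proj Γ) α)) {g : (Fin m → ℝ) × (Fin n → ℝ)} (hg : g.1 = 0) :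
    lift Γ α g = lift Γ α 0 := by
  have h1 := lift_mul_of_isLeftInvariant Γ hα (show SemidirectRn φ from g) 1
  rw [mul_one] at h1
  refine Eq.trans ?_ h1
  refine ContinuousAlternatingMap.ext fun v => ?_
  change _ = lift Γ α g (fun i => leftDeriv φ g.1 (v i))
  congr 1
  funext i
  rw [hg, leftDeriv_apply, actionRep_zero]

/-- If `ω = d_θ η`, then `ω` vanishes on `[G, G]`: on the plane spanned by `X, Y ∈ [G, G]` the form
`θ` vanishes, so the constant `ω(X, Y)` is `∂_X η(Y) - ∂_Y η(X)`, the divergence of a bounded vector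
field. -/
theorem lift_zero_eq_zero_of_twistedD_eq
    {ω : DiffForm ((Fin m → ℝ) × (Fin n → ℝ)) (LeftQuotient Γ) 2}
    {θ η : DiffForm ((Fin m → ℝ) × (Fin n → ℝ)) (LeftQuotient Γ) 1}
    (hs : IsSmoothForm θ) (hd : extd θ = 0) (hθ : IsLeftInvariant (pullback (proj Γ) θ))
    (hω : IsLeftInvariant (pullback (proj Γ) ω)) (hη : IsSmoothForm η) (h : twistedD θ η = ω)
    {X Y : (Fin m → ℝ) × (Fin n → ℝ)} (hX : X ∈ commutatorSubspace φ)
    (hY : Y ∈ commutatorSubspace φ) : lift Γ ω 0 ![X, Y] = 0 := by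
  have hX0 : X.1 = 0 := fst_eq_zero_of_mem_commutator φ hX
  have hY0 : Y.1 = 0 := fst_eq_zero_of_mem_commutator φ hY
  let P : ℝ × ℝ →L[ℝ] (Fin m → ℝ) × (Fin n → ℝ) :=
    (ContinuousLinearMap.fst ℝ ℝ ℝ).smulRight X + (ContinuousLinearMap.snd ℝ ℝ ℝ).smulRight Y
  have hP : ∀ p, P p = p.1 • X + p.2 • Y := fun _ => rfl
  have hP0 : ∀ p, (P p).1 = 0 := fun p => by simp [hP, hX0, hY0]
  have hsm : ContDiff ℝ 1 (lift Γ η) := (contDiff_lift Γ hη).of_le (mod_cast le_top)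
  have hev : ∀ w : (Fin m → ℝ) × (Fin n → ℝ), ContDiff ℝ 1 fun g => lift Γ η g ![w] := fun w =>
    (ContinuousAlternatingMap.apply ℝ ((Fin m → ℝ) × (Fin n → ℝ)) ℝ ![w]).contDiff.comp hsm
  have hbd : ∀ w : (Fin m → ℝ) × (Fin n → ℝ), w.1 = 0 → ∃ C, ∀ p, |lift Γ η (P p) ![w]| ≤ C := by
    intro w hw
    obtain ⟨C, hC⟩ := exists_forall_abs_lift_leftDeriv_le Γ hη ![w]
    refine ⟨C, fun p => ?_⟩
    have h1 := hC (P p)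
    simp only [hP0, leftDeriv_apply, actionRep_zero] at h1
    exact h1
  have hder : ∀ (w : (Fin m → ℝ) × (Fin n → ℝ)) (p u : ℝ × ℝ),
      fderiv ℝ (fun p => lift Γ η (P p) ![w]) p u =
        fderiv ℝ (fun g => lift Γ η g ![w]) (P p) (P u) := by
    intro w p u
    have h1 := (((hev w).differentiable one_ne_zero) (P p)).hasFDerivAt.comp p P.hasFDerivAt
    exact congrArg (fun f : ℝ × ℝ →L[ℝ] ℝ => f u) h1.fderiv
  obtain ⟨C, hC⟩ := hbd Y hY0
  obtain ⟨D, hD⟩ := hbd X hX0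
  refine eq_zero_of_bounded_of_divergence_eq (f := fun p => lift Γ η (P p) ![Y])
    (g := fun p => -lift Γ η (P p) ![X]) ((hev Y).comp P.contDiff) ((hev X).comp P.contDiff).neg
    hC (fun p => by rw [abs_neg]; exact hD p) fun p => ?_
  have h1 : extDeriv (lift Γ η) (P p) ![X, Y] = lift Γ ω 0 ![X, Y] := by
    rw [← lift_of_fst_eq_zero Γ hω (hP0 p), ← h, lift_twistedD Γ θ hη,
      ContinuousAlternatingMap.sub_apply, wedgeAlt_apply, lift_of_fst_eq_zero Γ hθ (hP0 p)]
    simp [Fin.sum_univ_two, lift_zero_eq_zero_of_mem_commutator Γ hs hd hθ hX,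
      lift_zero_eq_zero_of_mem_commutator Γ hs hd hθ hY]
  rw [extDeriv_apply (hsm.differentiable one_ne_zero _), Fin.sum_univ_two,
    show Fin.removeNth (0 : Fin 2) ![X, Y] = ![Y] by funext i; fin_cases i; rfl,
    show Fin.removeNth (1 : Fin 2) ![X, Y] = ![X] by funext i; fin_cases i; rfl] at h1
  rw [fderiv_fun_neg, neg_apply, hder, hder, show P (1, 0) = X by simp [hP],
    show P (0, 1) = Y by simp [hP]]
  simpa using h1

/-- Nondegeneracy of `ω` at the point `Γ · 1` is nondegeneracy of the lift at the base point `g` of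
the chart there; left translation by `g` carries it to the identity. -/
theorem lift_zero_nondegenerate {ω : DiffForm ((Fin m → ℝ) × (Fin n → ℝ)) (LeftQuotient Γ) 2}
    (hω : IsLeftInvariant (pullback (proj Γ) ω))
    (hnd : ∀ (x : LeftQuotient Γ) (v : TangentSpace 𝓘(ℝ, (Fin m → ℝ) × (Fin n → ℝ)) x),
      (∀ w, ω x ![v, w] = 0) → v = 0)
    (v : (Fin m → ℝ) × (Fin n → ℝ)) (hv : ∀ w, lift Γ ω 0 ![v, w] = 0) : v = 0 := by
  obtain ⟨g, hg⟩ : ∃ g, g = localSection Γ (proj Γ 1) (proj Γ 1) := ⟨_, rfl⟩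
  have h0 : ∀ w, leftDeriv φ (-g.1) (leftDeriv φ g.1 w) = w := fun w => by
    simp
  have h0' : ∀ w, leftDeriv φ g.1 (leftDeriv φ (-g.1) w) = w := fun w => by
    simp
  have h1 : leftDeriv φ g.1 v = 0 := by
    refine hnd (proj Γ 1) (leftDeriv φ g.1 v) fun w => ?_
    have h2 := lift_mul_of_isLeftInvariant Γ hω g 1
    rw [mul_one, hg, lift_localSection, ← hg] at h2
    have h3 := (congrArg (fun β => β ![v, leftDeriv φ (-g.1) w]) h2).trans (hv _)
    refine Eq.trans ?_ h3
    change _ = ω (proj Γ 1) (fun i => leftDeriv φ g.1 (![v, leftDeriv φ (-g.1) w] i))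
    congr 1
    funext i
    fin_cases i
    · rfl
    · exact (h0' w).symm
  rw [← h0 v, h1, map_zero]

end SemidirectRn

end LCSForms

end
open LCSForms LCSForms.SemidirectRn in
theorem mainTheorem4 {m n : ℕ} (φ : Multiplicative (Fin m → ℝ) →ₜ* GL (Fin n) ℝ)
    (hφ : (actionRep φ).IsSemisimpleRepresentation)
    (hdim : ((m : ℝ) + n) / 2 < Module.finrank ℝ (commutatorSubspace φ))
    (Γ : Subgroup (SemidirectRn φ)) [IsLattice Γ]
    (ω : DiffForm ((Fin m → ℝ) × (Fin n → ℝ)) (LeftQuotient Γ) 2)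
    (θ : DiffForm ((Fin m → ℝ) × (Fin n → ℝ)) (LeftQuotient Γ) 1)
    (hωθ : IsLCS ω θ)
    (hω : IsLeftInvariant (pullback (proj Γ) ω)) (hθ : IsLeftInvariant (pullback (proj Γ) θ)) :
    twistedClass θ ω hωθ.mem_twistedCocycles ≠ 0 := by
  intro h0
  rw [twistedClass, Submodule.Quotient.mk_eq_zero] at h0
  obtain ⟨η, hη, h⟩ := h0
  have hle := two_mul_finrank_le_of_isotropic (lift Γ ω 0)
    (lift_zero_nondegenerate Γ hω hωθ.nondegenerate) (commutatorSubspace φ)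
    fun X hX Y hY => lift_zero_eq_zero_of_twistedD_eq Γ hωθ.smooth_lee hωθ.closed_lee hθ hω hη h
      hX hY
  rw [Module.finrank_prod, Module.finrank_fin_fun, Module.finrank_fin_fun] at hle
  have hle' : (2 : ℝ) * Module.finrank ℝ (commutatorSubspace φ) ≤ m + n := mod_cast hle
  linarith
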